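/- Fix $a\in(0,1)$ and let $A_a=\{\lfloor m/a\rfloor : m\in\mathbb N\}$. The basic Hanner polytopes $P_n^a\subset\mathbb R^{2^n}$ are defined inductively by $P_0^a=[-1,1]$ and, for $n\ge 1$, using the orthogonal decomposition $\mathbb R^{2^n}=\mathbb R^{2^{n-1}}\times\mathbb R^{2^{n-1}}$ into the first and the last $2^{n-1}$ coordinates, $$P_n^a=\begin{cases}P_{n-1}^a\times P_{n-1}^a, & n\in A_a,\\ \operatorname{conv}\big((P_{n-1}^a\times\{0\})\cup(\{0\}\times P_{n-1}^a)\big), & n\notin A_a.\end{cases}$$ For a polytope $P$ let $f_k(P)$ denote the number of its (non-empty) $k$-dimensional faces. Let $\delta\in(0,1)$ and write $d=2^n$. 1. If $a\in\mathbb Q$, then there are constants $c,C>0$ depending only on $a$ and $\delta$ such that for all $n\ge 1$ $$c\,d^{\,a+\delta(1-a)}\le \log f_{\lfloor d^\delta\rfloor}(P_n^a)\le C\,d^{\,a+\delta(1-a)}.$$ 2. If $a\notin\mathbb Q$, then there is a constant $C>0$ depending only on $a$ and $\delta$ such that for all $n\ge 1$ $$\log f_{\lfloor d^\delta\rfloor}(P_n^a)=d^{\,a+\delta(1-a)+\varepsilon_n}\quad\text{for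 some real } \varepsilon_n \text{ with } |\varepsilon_n|\le \frac{C}{\sqrt{\log d}}.$$ -/

import Mathlib

noncomputable section

/-- The set `A_a = {⌊m / a⌋ : m ∈ ℕ}`; for `a ∈ (0, 1)` it has density `a` in `ℕ`. -/
def productSteps (a : ℝ) : Set ℕ := {n | ∃ m : ℕ, n = ⌊(m : ℝ) / a⌋₊}

/-- The projection of `ℝ^(2^(n+1)) = ℝ^(2^n) × ℝ^(2^n)` to the first factor
(the first `2^n` coordinates). -/
def fstHalf {n : ℕ} (x : Fin (2 ^ (n + 1)) → ℝ) : Fin (2 ^ n) → ℝ :=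
  fun i => x ⟨i, by have := i.isLt; rw [pow_succ]; omega⟩

/-- The projection of `ℝ^(2^(n+1)) = ℝ^(2^n) × ℝ^(2^n)` to the second factor
(the last `2^n` coordinates). -/
def sndHalf {n : ℕ} (x : Fin (2 ^ (n + 1)) → ℝ) : Fin (2 ^ n) → ℝ :=
  fun i => x ⟨2 ^ n + i, by have := i.isLt; rw [pow_succ]; omega⟩

/-- The product `P × Q` as a subset of `ℝ^(2^(n+1)) = ℝ^(2^n) × ℝ^(2^n)`. -/
def polyProd {n : ℕ} (P Q : Set (Fin (2 ^ n) → ℝ)) : Set (Fin (2 ^ (n + 1)) → ℝ) :=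
  {x | fstHalf x ∈ P ∧ sndHalf x ∈ Q}

/-- The convex hull of `P × {0}` and `{0} × Q` in `ℝ^(2^(n+1)) = ℝ^(2^n) × ℝ^(2^n)`. -/
def polySum {n : ℕ} (P Q : Set (Fin (2 ^ n) → ℝ)) : Set (Fin (2 ^ (n + 1)) → ℝ) :=
  convexHull ℝ (polyProd P {0} ∪ polyProd {0} Q)

open Classical in
/-- The basic Hanner polytopes `P_n^a ⊆ ℝ^(2^n)`: `P_0^a = [-1, 1]`, and `P_n^a` is the product
of two copies of `P_{n-1}^a` if `n ∈ A_a`, and the convex hull of two copies of `P_{n-1}^a` in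
complementary coordinate subspaces otherwise. -/
def hannerPolytope (a : ℝ) : (n : ℕ) → Set (Fin (2 ^ n) → ℝ)
  | 0 => {x | ∀ i, x i ∈ Set.Icc (-1 : ℝ) 1}
  | n + 1 =>
    if n + 1 ∈ productSteps a then polyProd (hannerPolytope a n) (hannerPolytope a n)
    else polySum (hannerPolytope a n) (hannerPolytope a n)

/-- The `k`-dimensional faces of a polytope `P ⊆ ℝ^N`: the non-empty sets of maximizers on `P`
of a linear functional, whose affine span has dimension `k`. -/
def kFaces {N : ℕ} (k : ℕ) (P : Set (Fin N → ℝ)) : Set (Set (Fin N → ℝ)) :=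
  {F | F.Nonempty ∧ IsExposed ℝ P F ∧ Module.finrank ℝ (vectorSpan ℝ F) = k}

/-- The face number `f_k(P)`: the number of `k`-dimensional faces of the polytope `P`. -/
def faceNumber {N : ℕ} (k : ℕ) (P : Set (Fin N → ℝ)) : ℕ := (kFaces k P).ncard

end

/-!
The number of product steps among `1, …, n` is `a n + O(1)`, and this is all that the estimate uses
of the set of product steps. Both parts follow from a two-sided bound
`c d ^ (a + δ (1 - a)) ≤ log f_k ≤ C d ^ (a + δ (1 - a))` for `k = ⌊d ^ δ⌋`, valid for every
`a ∈ (0, 1)` (`exists_log_faceNumber_bounds`); for irrational `a` it gives even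
`ε_n = O(1 / log d)`.

The face numbers obey polynomial recursions. Let `F_P = ∑ f_k(P) X ^ k` (`facePoly`), and let `G_P`
(`polarPoly`) count the empty and the proper faces, graded by dimension plus one, so that
`X F_P + 1 = G_P + X ^ (dim P + 1)`. Faces of a product are products of faces, so `F` is
multiplicative for products. The faces counted by `G_P` are the sets `{x ∈ P | l x = 1}` for
functionals `l ≤ 1` on `P`, and dimension plus one is the dimension of the linear span; since `l`
is at most `1` on a free sum exactly if it is on both summands, `G` is multiplicative for free sums.
In the proofs, `k ≈ 2 ^ j` with `j ≈ δ n`, and `m = n - j`.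

For the lower bound, `P_m` has at least `exp (c 2 ^ (a m))` vertices, edges and `2`-faces, because
the least of these three numbers is at least squared at each product step. The top `j` steps build `P_n` from `2 ^ j` copies of `P_m`, and
distributing the dimension `k` evenly among them gives
`f_k(P_n) ≥ exp (c 2 ^ j 2 ^ (a m))` (`log_coeff_lower_bound`).

For the upper bound, evaluate at `x = exp (-B 2 ^ (a m))`, where `a m` stands for an integer
close to it (`stepCount`). As long as `x F_i(x) ≤ 1`, which holds up
to the level `m`, a free sum multiplies `F_i(x)` by at most `3`, so `log F_m(x) ≤ B 2 ^ (a m)`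
(`log_aeval_le`). In the remaining `j` steps the logarithm at most doubles up to a constant. Hence
`log f_k ≤ log F_n(x) + k log (1 / x)` is at most a constant times `2 ^ j 2 ^ (a m)`
(`exists_log_coeff_upper_bound`).
-/

open Polynomial

/-! ### Generating polynomials of graded sets -/

/-- The generating polynomial `∑ X ^ r a`, over `a ∈ s`, of a set `s` graded by `r`; it is
meaningful for finite sets only. -/
noncomputable def gradedPoly {α : Type*} (s : Set α) (r : α → ℕ) : ℕ[X] := ∑ᶠ a ∈ s, X ^ r a

lemma coeff_gradedPoly {α : Type*} {s : Set α} (hs : s.Finite) (r : α → ℕ) (k : ℕ) :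
    (gradedPoly s r).coeff k = {a ∈ s | r a = k}.ncard := by
  classical
  have h : {a ∈ s | r a = k} = ↑(hs.toFinset.filter (fun a => r a = k)) := by
    ext; simp
  rw [gradedPoly, finsum_mem_eq_finite_toFinset_sum _ hs, finsetSum_coeff, h,
    Set.ncard_coe_finset, Finset.card_filter]
  simp only [coeff_X_pow, eq_comm]

lemma gradedPoly_eq_of_bijOn {α β : Type*} {s : Set α} {t : Set β} {r : α → ℕ} {r' : β → ℕ}
    (f : α → β) (h : Set.BijOn f s t) (hr : ∀ a ∈ s, r' (f a) = r a) :
    gradedPoly s r = gradedPoly t r' :=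
  finsum_mem_eq_of_bijOn f h fun a ha => by rw [hr a ha]

lemma gradedPoly_prod {α β : Type*} {s : Set α} {t : Set β} (hs : s.Finite) (ht : t.Finite)
    (r : α → ℕ) (r' : β → ℕ) :
    gradedPoly (s ×ˢ t) (fun p => r p.1 + r' p.2) = gradedPoly s r * gradedPoly t r' := by
  classical
  have h : s ×ˢ t = ↑(hs.toFinset ×ˢ ht.toFinset) := by ext; simp
  rw [gradedPoly, h, finsum_mem_coe_finset, Finset.sum_product, gradedPoly, gradedPoly,
    finsum_mem_eq_finite_toFinset_sum _ hs, finsum_mem_eq_finite_toFinset_sum _ ht,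
    Finset.sum_mul_sum]
  simp only [pow_add]

/-! ### Faces and polar faces -/

section Faces

variable {E : Type*} [NormedAddCommGroup E] [NormedSpace ℝ E]
variable {E' : Type*} [NormedAddCommGroup E'] [NormedSpace ℝ E']

/-- The non-empty exposed faces of `P`, among them `P` itself. -/
def exposedFaces (P : Set E) : Set (Set E) := {F | F.Nonempty ∧ IsExposed ℝ P F}

/-- The dimension of (the affine span of) a set. -/
noncomputable def affDim (F : Set E) : ℕ := Module.finrank ℝ (vectorSpan ℝ F)

/-- The faces `{x ∈ P | l x = 1}` cut out by the functionals `l` of the polar of `P`. If `0` is an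
interior point of `P`, these are the empty face and the proper faces. -/
def polarFaces (P : Set E) : Set (Set E) :=
  {F | ∃ l : StrongDual ℝ E, (∀ x ∈ P, l x ≤ 1) ∧ F = {x ∈ P | l x = 1}}

/-- The dimension of the linear span of a set. For a polar face this is its dimension plus one, the
empty face having dimension `-1`. -/
noncomputable def linDim (F : Set E) : ℕ := Module.finrank ℝ (Submodule.span ℝ F)

/-- The generating polynomial of the face numbers. -/
noncomputable def facePoly (P : Set E) : ℕ[X] := gradedPoly (exposedFaces P) affDim

/-- The generating polynomial of the polar faces, graded by `linDim`. -/
noncomputable def polarPoly (P : Set E) : ℕ[X] := gradedPoly (polarFaces P) linDim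

/-- `P` contains the origin, and every non-zero functional is positive somewhere on `P`. For convex
sets in finite dimension this says that the origin is an interior point. -/
structure SurroundsZero (P : Set E) : Prop where
  zero_mem : (0 : E) ∈ P
  exists_pos : ∀ l : StrongDual ℝ E, l ≠ 0 → ∃ x ∈ P, 0 < l x

lemma self_mem_exposedFaces {P : Set E} (hP : P.Nonempty) : P ∈ exposedFaces P :=
  ⟨hP, fun _ => ⟨0, by simp⟩⟩

lemma SurroundsZero.exposedFaces_eq {P : Set E} (hP : SurroundsZero P) :
    exposedFaces P = insert P (polarFaces P \ {∅}) := by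
  ext F
  simp only [Set.mem_insert_iff, Set.mem_sdiff, Set.mem_singleton_iff, ← Set.nonempty_iff_ne_empty]
  constructor
  · rintro ⟨hne, hF⟩
    obtain ⟨l, hl⟩ := hF hne
    by_cases h0 : l = 0
    · left; rw [hl, h0]; simp
    right
    obtain ⟨x₀, hx₀⟩ := id hne
    have hx₀' := hx₀
    rw [hl] at hx₀'
    obtain ⟨y, hy, hly⟩ := hP.exists_pos l h0
    have hpos : 0 < l x₀ := hly.trans_le (hx₀'.2 y hy)
    refine ⟨⟨(l x₀)⁻¹ • l, fun x hx => ?_, ?_⟩, hne⟩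
    · have := hx₀'.2 x hx
      simp only [smul_apply, smul_eq_mul]
      rw [inv_mul_le_iff₀ hpos]; simpa using this
    · rw [hl]
      ext x
      simp only [Set.mem_ofPred_eq, smul_apply, smul_eq_mul,
        inv_mul_eq_iff_eq_mul₀ hpos.ne', mul_one]
      refine and_congr_right fun hx => ⟨fun h => ?_, fun h y hy => ?_⟩
      · exact le_antisymm (hx₀'.2 x hx) (h x₀ hx₀'.1)
      · rw [h]; exact hx₀'.2 y hy
  · rintro (rfl | ⟨⟨l, hl, rfl⟩, hne⟩)
    · exact self_mem_exposedFaces ⟨0, hP.zero_mem⟩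
    · refine ⟨hne, fun _ => ⟨l, ?_⟩⟩
      obtain ⟨x₀, hx₀, hlx₀⟩ := hne
      ext x
      simp only [Set.mem_ofPred_eq]
      refine and_congr_right fun hx => ⟨fun h y hy => ?_, fun h => ?_⟩
      · rw [h]; exact hl y hy
      · exact le_antisymm (hl x hx) (hlx₀ ▸ h x₀ hx₀)

lemma empty_mem_polarFaces (P : Set E) : ∅ ∈ polarFaces P :=
  ⟨0, by simp, by simp⟩

lemma SurroundsZero.notMem_polarFaces {P : Set E} (hP : SurroundsZero P) : P ∉ polarFaces P := by
  rintro ⟨l, -, h⟩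
  have := hP.zero_mem
  rw [h] at this
  simpa using this.2

/-- A non-empty set in an affine hyperplane off the origin spans a linear space of one dimension
more than its affine span. -/
lemma linDim_eq_affDim_add_one [FiniteDimensional ℝ E] {F : Set E} (hF : F.Nonempty)
    (l : StrongDual ℝ E) (hl : ∀ x ∈ F, l x = 1) : linDim F = affDim F + 1 := by
  obtain ⟨x₀, hx₀⟩ := hF
  have hx₀0 : x₀ ≠ 0 := by rintro rfl; simpa using hl 0 hx₀
  have hker : vectorSpan ℝ F ≤ LinearMap.ker (l : E →ₗ[ℝ] ℝ) := by
    rw [vectorSpan, Submodule.span_le]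
    rintro _ ⟨x, hx, y, hy, rfl⟩
    simp [hl x hx, hl y hy]
  have hsup : Submodule.span ℝ F = vectorSpan ℝ F ⊔ Submodule.span ℝ {x₀} := by
    apply le_antisymm
    · rw [Submodule.span_le]
      intro x hx
      have : x = (x -ᵥ x₀) + x₀ := by simp
      rw [this]
      exact Submodule.add_mem_sup (vsub_mem_vectorSpan ℝ hx hx₀)
        (Submodule.mem_span_singleton_self x₀)
    · refine sup_le ?_ (Submodule.span_mono (by simpa using hx₀))
      rw [vectorSpan, Submodule.span_le]
      rintro _ ⟨x, hx, y, hy, rfl⟩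
      exact Submodule.sub_mem _ (Submodule.subset_span hx) (Submodule.subset_span hy)
  have hinf : vectorSpan ℝ F ⊓ Submodule.span ℝ {x₀} = ⊥ := by
    rw [eq_bot_iff]
    rintro z ⟨hz1, hz2⟩
    obtain ⟨c, rfl⟩ := Submodule.mem_span_singleton.1 hz2
    have := hker hz1
    simp only [LinearMap.mem_ker, map_smul, ContinuousLinearMap.coe_coe, hl x₀ hx₀, smul_eq_mul,
      mul_one] at this
    simp [this]
  have := Submodule.finrank_sup_add_finrank_inf_eq (vectorSpan ℝ F) (Submodule.span ℝ {x₀})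
  rw [hinf, ← hsup, finrank_bot, finrank_span_singleton hx₀0] at this
  simpa [linDim, affDim] using this

lemma SurroundsZero.affDim_eq [FiniteDimensional ℝ E] {P : Set E} (hP : SurroundsZero P) :
    affDim P = Module.finrank ℝ E := by
  have : vectorSpan ℝ P = ⊤ := by
    by_contra h
    obtain ⟨f, hf0, hf⟩ := Submodule.exists_le_ker_of_lt_top _ (lt_top_iff_ne_top.2 h)
    obtain ⟨x, hx, hlx⟩ := hP.exists_pos (LinearMap.toContinuousLinearMap f) (by simpa using hf0)
    have := hf (vsub_mem_vectorSpan ℝ hx hP.zero_mem)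
    simp at this hlx
    exact hlx.ne' this
  rw [affDim, this, finrank_top]

lemma SurroundsZero.finite_exposedFaces_iff {P : Set E} (hP : SurroundsZero P) :
    (exposedFaces P).Finite ↔ (polarFaces P).Finite := by
  rw [hP.exposedFaces_eq, Set.finite_insert]
  exact ⟨fun h => (h.union (Set.finite_singleton ∅)).subset (by intro x; simp; tauto),
    fun h => h.subset Set.sdiff_subset⟩

/-- Passage between the two generating polynomials: the polar faces are the proper faces together
with the empty face, and their degree is shifted by one. -/
lemma SurroundsZero.X_mul_facePoly_add_one [FiniteDimensional ℝ E] {P : Set E}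
    (hP : SurroundsZero P) (hfin : (exposedFaces P).Finite) :
    X * facePoly P + 1 = polarPoly P + X ^ (Module.finrank ℝ E + 1) := by
  have hfin' := hP.finite_exposedFaces_iff.1 hfin
  have hfin'' : (polarFaces P \ {∅}).Finite := hfin'.subset Set.sdiff_subset
  have h1 : polarPoly P = 1 + ∑ᶠ F ∈ polarFaces P \ {∅}, (X : ℕ[X]) ^ linDim F := by
    have : polarFaces P = insert ∅ (polarFaces P \ {∅}) := by
      rw [Set.insert_sdiff_singleton, Set.insert_eq_of_mem (empty_mem_polarFaces P)]
    rw [polarPoly, gradedPoly, this, finsum_mem_insert _ (by simp) hfin'', ← this]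
    rw [linDim, Submodule.span_empty, finrank_bot, pow_zero]
  have h2 : facePoly P = X ^ Module.finrank ℝ E
      + ∑ᶠ F ∈ polarFaces P \ {∅}, (X : ℕ[X]) ^ affDim F := by
    rw [facePoly, gradedPoly, hP.exposedFaces_eq, finsum_mem_insert _ _ hfin'', hP.affDim_eq]
    exact fun h => hP.notMem_polarFaces h.1
  have h3 : ∑ᶠ F ∈ polarFaces P \ {∅}, (X : ℕ[X]) ^ linDim F
      = X * ∑ᶠ F ∈ polarFaces P \ {∅}, (X : ℕ[X]) ^ affDim F := by
    rw [mul_finsum_mem]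
    refine finsum_mem_congr rfl fun F hF => ?_
    obtain ⟨⟨l, hl, rfl⟩, hne⟩ := hF
    rw [linDim_eq_affDim_add_one (Set.nonempty_iff_ne_empty.2 hne) l (fun x hx => hx.2), pow_succ']
  rw [h1, h2, h3]
  ring

/-! ### Products -/

lemma SurroundsZero.prod {P : Set E} {Q : Set E'} (hP : SurroundsZero P) (hQ : SurroundsZero Q) :
    SurroundsZero (P ×ˢ Q) where
  zero_mem := ⟨hP.zero_mem, hQ.zero_mem⟩
  exists_pos l hl := by
    by_cases h1 : l.comp (ContinuousLinearMap.inl ℝ E E') = 0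
    · have h2 : l.comp (ContinuousLinearMap.inr ℝ E E') ≠ 0 := by
        intro h2
        apply hl
        rw [← ContinuousLinearMap.coprod_comp_inl_inr l, h1, h2]
        ext <;> simp
      obtain ⟨x, hx, hlx⟩ := hQ.exists_pos _ h2
      exact ⟨(0, x), ⟨hP.zero_mem, hx⟩, by simpa using hlx⟩
    · obtain ⟨x, hx, hlx⟩ := hP.exists_pos _ h1
      exact ⟨(x, 0), ⟨hx, hQ.zero_mem⟩, by simpa using hlx⟩

lemma bijOn_exposedFaces_prod (P : Set E) (Q : Set E') :
    Set.BijOn (fun p : Set E × Set E' => p.1 ×ˢ p.2) (exposedFaces P ×ˢ exposedFaces Q)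
      (exposedFaces (P ×ˢ Q)) := by
  refine ⟨?_, ?_, ?_⟩
  · rintro ⟨F, G⟩ ⟨⟨hF, hF'⟩, ⟨hG, hG'⟩⟩
    refine ⟨hF.prod hG, fun _ => ?_⟩
    obtain ⟨l, hl⟩ := hF' hF
    obtain ⟨m, hm⟩ := hG' hG
    refine ⟨l.coprod m, ?_⟩
    simp only at hl hm ⊢
    obtain ⟨x₀, hx₀⟩ := hF
    obtain ⟨y₀, hy₀⟩ := hG
    rw [hl] at hx₀
    rw [hm] at hy₀
    ext ⟨x, y⟩
    rw [hl, hm]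
    simp only [Set.mem_prod, Set.mem_ofPred_eq, ContinuousLinearMap.coprod_apply, Prod.forall]
    constructor
    · rintro ⟨⟨hx, hx'⟩, ⟨hy, hy'⟩⟩
      exact ⟨⟨hx, hy⟩, fun x' y' h => add_le_add (hx' _ h.1) (hy' _ h.2)⟩
    · rintro ⟨⟨hx, hy⟩, h⟩
      refine ⟨⟨hx, fun x' h' => ?_⟩, ⟨hy, fun y' h' => ?_⟩⟩
      · simpa using h x' y ⟨h', hy⟩
      · simpa using h x y' ⟨hx, h'⟩
  · rintro ⟨F, G⟩ ⟨⟨hF, -⟩, ⟨hG, -⟩⟩ ⟨F', G'⟩ ⟨⟨hF', -⟩, ⟨hG', -⟩⟩ h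
    simp only at h
    rcases (Set.prod_eq_prod_iff_of_nonempty (hF.prod hG)).1 h with ⟨h1, h2⟩
    exact Prod.ext h1 h2
  · rintro J ⟨hJ, hJ'⟩
    obtain ⟨l, hl⟩ := hJ' hJ
    obtain ⟨⟨x₀, y₀⟩, h₀⟩ := hJ
    rw [hl] at h₀
    have hsplit : ∀ x y, l (x, y) = l (x, 0) + l (0, y) := fun x y => by
      rw [← map_add, Prod.mk_add_mk, add_zero, zero_add]
    obtain ⟨⟨hx₀, hy₀⟩, h₀⟩ := h₀
    refine ⟨({x ∈ P | ∀ x' ∈ P, l (x', 0) ≤ l (x, 0)}, {y ∈ Q | ∀ y' ∈ Q, l (0, y') ≤ l (0, y)}),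
      ⟨⟨⟨x₀, hx₀, fun x' h' => ?_⟩, fun _ => ⟨l.comp (ContinuousLinearMap.inl ℝ E E'), ?_⟩⟩,
        ⟨⟨y₀, hy₀, fun y' h' => ?_⟩, fun _ => ⟨l.comp (ContinuousLinearMap.inr ℝ E E'), ?_⟩⟩⟩, ?_⟩
    · have := h₀ (x', y₀) ⟨h', hy₀⟩
      rw [hsplit x₀ y₀, hsplit] at this
      linarith
    · simp
    · have := h₀ (x₀, y') ⟨hx₀, h'⟩
      rw [hsplit x₀ y₀, hsplit] at this
      linarith
    · simp
    · rw [hl]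
      ext ⟨x, y⟩
      simp only [Set.mem_prod, Set.mem_ofPred_eq, Prod.forall]
      constructor
      · rintro ⟨⟨hx, hx'⟩, ⟨hy, hy'⟩⟩
        refine ⟨⟨hx, hy⟩, fun x' y' h => ?_⟩
        rw [hsplit, hsplit x]
        exact add_le_add (hx' _ h.1) (hy' _ h.2)
      · rintro ⟨⟨hx, hy⟩, h⟩
        refine ⟨⟨hx, fun x' h' => ?_⟩, ⟨hy, fun y' h' => ?_⟩⟩
        · have := h x' y ⟨h', hy⟩
          rw [hsplit x y, hsplit] at this
          linarith
        · have := h x y' ⟨hx, h'⟩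
          rw [hsplit x y, hsplit] at this
          linarith

lemma finrank_submodule_prod [FiniteDimensional ℝ E] [FiniteDimensional ℝ E']
    (p : Submodule ℝ E) (q : Submodule ℝ E') :
    Module.finrank ℝ (p.prod q) = Module.finrank ℝ p + Module.finrank ℝ q := by
  have hr : p.prod q = LinearMap.range (p.subtype.prodMap q.subtype) := by
    rw [LinearMap.range_prodMap, Submodule.range_subtype, Submodule.range_subtype]
  rw [hr, LinearMap.finrank_range_of_inj, Module.finrank_prod]
  exact Function.Injective.prodMap p.injective_subtype q.injective_subtype

lemma affDim_prod [FiniteDimensional ℝ E] [FiniteDimensional ℝ E'] {F : Set E} {G : Set E'}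
    (hF : F.Nonempty) (hG : G.Nonempty) : affDim (F ×ˢ G) = affDim F + affDim G := by
  have : vectorSpan ℝ (F ×ˢ G) = (vectorSpan ℝ F).prod (vectorSpan ℝ G) := by
    obtain ⟨x₀, hx₀⟩ := hF
    obtain ⟨y₀, hy₀⟩ := hG
    apply le_antisymm
    · rw [vectorSpan, Submodule.span_le]
      rintro _ ⟨⟨x, y⟩, ⟨hx, hy⟩, ⟨x', y'⟩, ⟨hx', hy'⟩, rfl⟩
      exact ⟨vsub_mem_vectorSpan ℝ hx hx', vsub_mem_vectorSpan ℝ hy hy'⟩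
    · rw [LinearMap.prod_eq_sup_map]
      refine sup_le ?_ ?_
      · rw [vectorSpan, Submodule.map_span, Submodule.span_le]
        rintro _ ⟨_, ⟨x, hx, x', hx', rfl⟩, rfl⟩
        have : ((x, y₀) : E × E') -ᵥ (x', y₀) ∈ vectorSpan ℝ (F ×ˢ G) :=
          vsub_mem_vectorSpan ℝ ⟨hx, hy₀⟩ ⟨hx', hy₀⟩
        simpa using this
      · rw [vectorSpan, Submodule.map_span, Submodule.span_le]
        rintro _ ⟨_, ⟨x, hx, x', hx', rfl⟩, rfl⟩
        have : ((x₀, x) : E × E') -ᵥ (x₀, x') ∈ vectorSpan ℝ (F ×ˢ G) :=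
          vsub_mem_vectorSpan ℝ ⟨hx₀, hx⟩ ⟨hx₀, hx'⟩
        simpa using this
  rw [affDim, this, finrank_submodule_prod, affDim, affDim]

lemma finite_exposedFaces_prod {P : Set E} {Q : Set E'} (hP : (exposedFaces P).Finite)
    (hQ : (exposedFaces Q).Finite) : (exposedFaces (P ×ˢ Q)).Finite :=
  (bijOn_exposedFaces_prod P Q).finite_iff_finite.1 (hP.prod hQ)

lemma facePoly_prod [FiniteDimensional ℝ E] [FiniteDimensional ℝ E'] {P : Set E} {Q : Set E'}
    (hP : (exposedFaces P).Finite) (hQ : (exposedFaces Q).Finite) :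
    facePoly (P ×ˢ Q) = facePoly P * facePoly Q := by
  rw [facePoly, facePoly, facePoly, ← gradedPoly_prod hP hQ]
  exact (gradedPoly_eq_of_bijOn _ (bijOn_exposedFaces_prod P Q)
    fun p hp => affDim_prod hp.1.1 hp.2.1).symm

/-! ### Free sums -/

/-- The convex hull of `P` and `Q`, placed in complementary subspaces. -/
def freeSum (P : Set E) (Q : Set E') : Set (E × E') := convexHull ℝ (P ×ˢ {0} ∪ {0} ×ˢ Q)

lemma inl_mem_freeSum {P : Set E} {x : E} (hx : x ∈ P) (Q : Set E') : (x, 0) ∈ freeSum P Q :=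
  subset_convexHull _ _ (Or.inl ⟨hx, rfl⟩)

lemma inr_mem_freeSum (P : Set E) {Q : Set E'} {y : E'} (hy : y ∈ Q) : (0, y) ∈ freeSum P Q :=
  subset_convexHull _ _ (Or.inr ⟨rfl, hy⟩)

lemma SurroundsZero.freeSum {P : Set E} {Q : Set E'} (hP : SurroundsZero P)
    (hQ : SurroundsZero Q) : SurroundsZero (freeSum P Q) where
  zero_mem := inl_mem_freeSum hP.zero_mem Q
  exists_pos l hl := by
    by_cases h1 : l.comp (ContinuousLinearMap.inl ℝ E E') = 0
    · have h2 : l.comp (ContinuousLinearMap.inr ℝ E E') ≠ 0 := by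
        intro h2
        apply hl
        rw [← ContinuousLinearMap.coprod_comp_inl_inr l, h1, h2]
        ext <;> simp
      obtain ⟨x, hx, hlx⟩ := hQ.exists_pos _ h2
      exact ⟨(0, x), inr_mem_freeSum P hx, by simpa using hlx⟩
    · obtain ⟨x, hx, hlx⟩ := hP.exists_pos _ h1
      exact ⟨(x, 0), inl_mem_freeSum hx Q, by simpa using hlx⟩

/-- Passing to the points where a functional attains its upper bound commutes with the convex
hull. -/
lemma setOf_mem_convexHull_eq {A : Set E} (l : StrongDual ℝ E) (hl : ∀ x ∈ A, l x ≤ 1) :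
    {x ∈ convexHull ℝ A | l x = 1} = convexHull ℝ {x ∈ A | l x = 1} := by
  have hle : convexHull ℝ A ⊆ {x | l x ≤ 1} :=
    convexHull_min hl (convex_halfSpace_le l.isLinear 1)
  have heq : convexHull ℝ {x ∈ A | l x = 1} ⊆ {x | l x = 1} :=
    convexHull_min (fun x hx => hx.2) (convex_hyperplane l.isLinear 1)
  apply Set.Subset.antisymm
  · -- The points off the hyperplane `l = 1`, together with the smaller hull, form a convex set.
    have hconv : Convex ℝ {x | l x < 1 ∨ x ∈ convexHull ℝ {x ∈ A | l x = 1}} := by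
      rw [convex_iff_forall_pos]
      intro x hx y hy s t hs ht hst
      have hx1 : l x ≤ 1 := hx.elim le_of_lt fun h => (heq h).le
      have hy1 : l y ≤ 1 := hy.elim le_of_lt fun h => (heq h).le
      have hval : l (s • x + t • y) = s * l x + t * l y := by simp
      rcases hx with hx | hx
      · left; rw [hval]; nlinarith
      rcases hy with hy | hy
      · left; rw [hval]; nlinarith
      exact Or.inr (convex_convexHull ℝ _ hx hy hs.le ht.le hst)
    have hsub : A ⊆ {x | l x < 1 ∨ x ∈ convexHull ℝ {x ∈ A | l x = 1}} := fun x hx =>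
      (hl x hx).lt_or_eq.imp id fun h => subset_convexHull ℝ _ ⟨hx, h⟩
    rintro x ⟨hx, hlx⟩
    exact (convexHull_min hsub hconv hx).resolve_left hlx.not_lt
  · exact fun x hx => ⟨convexHull_mono (fun y hy => hy.1) hx, heq hx⟩

lemma freeSum_setOf_eq {P : Set E} {Q : Set E'} {l : StrongDual ℝ E} {m : StrongDual ℝ E'}
    (hl : ∀ x ∈ P, l x ≤ 1) (hm : ∀ y ∈ Q, m y ≤ 1) :
    freeSum {x ∈ P | l x = 1} {y ∈ Q | m y = 1} = {z ∈ freeSum P Q | l.coprod m z = 1} := by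
  rw [freeSum, freeSum, setOf_mem_convexHull_eq]
  · congr 1
    ext ⟨x, y⟩
    simp only [Set.mem_union, Set.mem_prod, Set.mem_ofPred_eq, Set.mem_singleton_iff,
      ContinuousLinearMap.coprod_apply]
    constructor
    · rintro (⟨⟨hx, hx'⟩, rfl⟩ | ⟨rfl, hy, hy'⟩) <;> simp [*]
    · rintro ⟨⟨hx, rfl⟩ | ⟨rfl, hy⟩, h⟩
      · left; simpa [hx] using h
      · right; simpa [hy] using h
  · rintro ⟨x, y⟩ (⟨hx, rfl⟩ | ⟨rfl, hy⟩)
    · simpa using hl x hx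
    · simpa using hm y hy

lemma bijOn_polarFaces_freeSum (P : Set E) (Q : Set E') :
    Set.BijOn (fun p : Set E × Set E' => freeSum p.1 p.2) (polarFaces P ×ˢ polarFaces Q)
      (polarFaces (freeSum P Q)) := by
  -- The summands of a polar face `J` are recovered as `{x ∈ P | (x, 0) ∈ J}` and its mirror image.
  have key : ∀ {F : Set E} {G : Set E'}, F ∈ polarFaces P → G ∈ polarFaces Q →
      F = {x ∈ P | (x, 0) ∈ freeSum F G} ∧ G = {y ∈ Q | (0, y) ∈ freeSum F G} := by
    rintro _ _ ⟨l, hl, rfl⟩ ⟨m, hm, rfl⟩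
    rw [freeSum_setOf_eq hl hm]
    constructor
    · ext x
      simp only [Set.mem_ofPred_eq, ContinuousLinearMap.coprod_apply, map_zero, add_zero]
      exact and_congr_right fun hx => by simp [inl_mem_freeSum hx Q]
    · ext y
      simp only [Set.mem_ofPred_eq, ContinuousLinearMap.coprod_apply, map_zero, zero_add]
      exact and_congr_right fun hy => by simp [inr_mem_freeSum P hy]
  refine ⟨?_, ?_, ?_⟩
  · rintro ⟨_, _⟩ ⟨⟨l, hl, rfl⟩, ⟨m, hm, rfl⟩⟩
    refine ⟨l.coprod m, ?_, freeSum_setOf_eq hl hm⟩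
    refine convexHull_min ?_ (convex_halfSpace_le (l.coprod m).isLinear 1)
    rintro ⟨x, y⟩ (⟨hx, rfl⟩ | ⟨rfl, hy⟩)
    · change l.coprod m (x, 0) ≤ 1
      simpa using hl x hx
    · change l.coprod m (0, y) ≤ 1
      simpa using hm y hy
  · rintro ⟨F, G⟩ ⟨hF, hG⟩ ⟨F', G'⟩ ⟨hF', hG'⟩ h
    simp only at h
    have h1 := key hF hG
    have h2 := key hF' hG'
    rw [h] at h1
    rw [Prod.mk.injEq]
    exact ⟨h1.1.trans h2.1.symm, h1.2.trans h2.2.symm⟩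
  · rintro _ ⟨l, hl, rfl⟩
    have hl1 : ∀ x ∈ P, l.comp (ContinuousLinearMap.inl ℝ E E') x ≤ 1 := fun x hx =>
      hl _ (inl_mem_freeSum hx Q)
    have hl2 : ∀ y ∈ Q, l.comp (ContinuousLinearMap.inr ℝ E E') y ≤ 1 := fun y hy =>
      hl _ (inr_mem_freeSum P hy)
    refine ⟨({x ∈ P | l.comp (ContinuousLinearMap.inl ℝ E E') x = 1},
      {y ∈ Q | l.comp (ContinuousLinearMap.inr ℝ E E') y = 1}),
      ⟨⟨_, hl1, rfl⟩, ⟨_, hl2, rfl⟩⟩, ?_⟩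
    exact (freeSum_setOf_eq hl1 hl2).trans (by rw [ContinuousLinearMap.coprod_comp_inl_inr])

lemma linDim_freeSum [FiniteDimensional ℝ E] [FiniteDimensional ℝ E'] (F : Set E) (G : Set E') :
    linDim (freeSum F G) = linDim F + linDim G := by
  have h1 : Submodule.span ℝ (freeSum F G) = Submodule.span ℝ (F ×ˢ {0} ∪ {0} ×ˢ G) := by
    apply le_antisymm
    · rw [Submodule.span_le]
      exact convexHull_min Submodule.subset_span (Submodule.convex _)
    · exact Submodule.span_mono (subset_convexHull ℝ _)
  have h2 : Submodule.span ℝ (freeSum F G)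
      = (Submodule.span ℝ F).prod (Submodule.span ℝ G) := by
    rw [h1, LinearMap.prod_eq_sup_map, Submodule.span_union, Submodule.map_span,
      Submodule.map_span]
    congr 2
    · ext ⟨x, y⟩; simp [eq_comm]
    · ext ⟨x, y⟩; simp [eq_comm, and_comm]
  rw [linDim, h2, finrank_submodule_prod, linDim, linDim]

lemma finite_exposedFaces_freeSum {P : Set E} {Q : Set E'} (hP : SurroundsZero P)
    (hQ : SurroundsZero Q) (hP' : (exposedFaces P).Finite) (hQ' : (exposedFaces Q).Finite) :
    (exposedFaces (freeSum P Q)).Finite := by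
  rw [SurroundsZero.finite_exposedFaces_iff (hP.freeSum hQ)]
  exact (bijOn_polarFaces_freeSum P Q).finite_iff_finite.1
    ((hP.finite_exposedFaces_iff.1 hP').prod (hQ.finite_exposedFaces_iff.1 hQ'))

lemma polarPoly_freeSum [FiniteDimensional ℝ E] [FiniteDimensional ℝ E'] {P : Set E} {Q : Set E'}
    (hP : (polarFaces P).Finite) (hQ : (polarFaces Q).Finite) :
    polarPoly (freeSum P Q) = polarPoly P * polarPoly Q := by
  rw [polarPoly, polarPoly, polarPoly, ← gradedPoly_prod hP hQ]
  exact (gradedPoly_eq_of_bijOn _ (bijOn_polarFaces_freeSum P Q)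
    fun p _ => linDim_freeSum p.1 p.2).symm

/-! ### Linear equivalences -/

lemma SurroundsZero.preimage (e : E ≃L[ℝ] E') {P : Set E'} (hP : SurroundsZero P) :
    SurroundsZero (e ⁻¹' P) where
  zero_mem := by simpa using hP.zero_mem
  exists_pos l hl := by
    obtain ⟨x, hx, hlx⟩ := hP.exists_pos (l.comp (e.symm : E' →L[ℝ] E)) (by
      intro h
      apply hl
      ext x
      simpa using DFunLike.congr_fun h (e x))
    exact ⟨e.symm x, by simpa using hx, by simpa using hlx⟩

lemma bijOn_exposedFaces_preimage (e : E ≃L[ℝ] E') (P : Set E') :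
    Set.BijOn (fun F => e ⁻¹' F) (exposedFaces P) (exposedFaces (e ⁻¹' P)) := by
  refine ⟨?_, ?_, ?_⟩
  · rintro F ⟨hF, hF'⟩
    obtain ⟨l, hl⟩ := hF' hF
    refine ⟨hF.preimage e.surjective, fun _ => ⟨l.comp (e : E →L[ℝ] E'), ?_⟩⟩
    ext x
    simp only [Set.mem_preimage]
    rw [hl]
    simp only [Set.mem_ofPred_eq, ContinuousLinearMap.comp_apply,
      ContinuousLinearEquiv.coe_coe]
    exact and_congr_right fun _ => ⟨fun h y hy => h _ hy, fun h y hy => by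
      simpa using h (e.symm y) (by simpa using hy)⟩
  · exact fun F _ G _ h => Set.preimage_injective.2 e.surjective h
  · rintro F ⟨hF, hF'⟩
    obtain ⟨l, hl⟩ := hF' hF
    refine ⟨e.symm ⁻¹' F, ⟨hF.preimage e.symm.surjective,
      fun _ => ⟨l.comp (e.symm : E' →L[ℝ] E), ?_⟩⟩, by ext; simp⟩
    ext x
    simp only [Set.mem_preimage]
    rw [hl]
    simp only [Set.mem_ofPred_eq, Set.mem_preimage, ContinuousLinearMap.comp_apply,
      ContinuousLinearEquiv.coe_coe, ContinuousLinearEquiv.apply_symm_apply]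
    exact and_congr_right fun _ => ⟨fun h y hy => h _ (by simpa using hy), fun h y hy => by
      simpa using h (e y) hy⟩

lemma affDim_preimage (e : E ≃L[ℝ] E') (F : Set E') : affDim (e ⁻¹' F) = affDim F := by
  have : vectorSpan ℝ F = (vectorSpan ℝ (e ⁻¹' F)).map (e : E →ₗ[ℝ] E') := by
    have himg : F = e '' (e ⁻¹' F) := (Set.image_preimage_eq F e.surjective).symm
    conv_lhs => rw [himg]
    rw [vectorSpan, vectorSpan, Submodule.map_span]
    congr 1
    ext x
    constructor
    · rintro ⟨_, ⟨y, hy, rfl⟩, _, ⟨z, hz, rfl⟩, rfl⟩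
      exact ⟨y - z, ⟨y, hy, z, hz, rfl⟩, by simp⟩
    · rintro ⟨_, ⟨y, hy, z, hz, rfl⟩, rfl⟩
      exact ⟨e y, ⟨y, hy, rfl⟩, e z, ⟨z, hz, rfl⟩, by simp⟩
  rw [affDim, affDim, this]
  exact (LinearEquiv.finrank_map_eq e.toLinearEquiv _).symm

lemma finite_exposedFaces_preimage (e : E ≃L[ℝ] E') {P : Set E'} (hP : (exposedFaces P).Finite) :
    (exposedFaces (e ⁻¹' P)).Finite :=
  (bijOn_exposedFaces_preimage e P).finite_iff_finite.1 hP

lemma facePoly_preimage (e : E ≃L[ℝ] E') (P : Set E') : facePoly (e ⁻¹' P) = facePoly P :=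
  (gradedPoly_eq_of_bijOn _ (bijOn_exposedFaces_preimage e P)
    fun F _ => affDim_preimage e F).symm

end Faces

/-! ### The face polynomials of Hanner polytopes -/

/-- The identification `ℝ^(2^(n+1)) = ℝ^(2^n) × ℝ^(2^n)` by first and last coordinates. -/
noncomputable def halvesEquiv (n : ℕ) :
    (Fin (2 ^ (n + 1)) → ℝ) ≃L[ℝ] (Fin (2 ^ n) → ℝ) × (Fin (2 ^ n) → ℝ) :=
  ((LinearEquiv.funCongrLeft ℝ ℝ
      (finSumFinEquiv.trans (finCongr (by rw [pow_succ, mul_two])) :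
        Fin (2 ^ n) ⊕ Fin (2 ^ n) ≃ Fin (2 ^ (n + 1)))).trans
    (LinearEquiv.sumArrowLequivProdArrow _ _ ℝ ℝ)).toContinuousLinearEquiv

lemma halvesEquiv_apply {n : ℕ} (x : Fin (2 ^ (n + 1)) → ℝ) :
    halvesEquiv n x = (fstHalf x, sndHalf x) := by
  ext i <;> rfl

lemma polyProd_eq_preimage {n : ℕ} (P Q : Set (Fin (2 ^ n) → ℝ)) :
    polyProd P Q = halvesEquiv n ⁻¹' (P ×ˢ Q) := by
  ext x
  simp [polyProd, halvesEquiv_apply]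

lemma polySum_eq_preimage {n : ℕ} (P Q : Set (Fin (2 ^ n) → ℝ)) :
    polySum P Q = halvesEquiv n ⁻¹' (freeSum P Q) := by
  have h : ∀ s, halvesEquiv n ⁻¹' s = (halvesEquiv n).symm '' s := fun s => by
    rw [ContinuousLinearEquiv.image_symm_eq_preimage]
  rw [polySum, polyProd_eq_preimage, polyProd_eq_preimage, ← Set.preimage_union, h, h, freeSum]
  exact (LinearMap.image_convexHull
    ((halvesEquiv n).symm.toLinearEquiv.toLinearMap) (P ×ˢ {0} ∪ {0} ×ˢ Q)).symm

/-- The generating polynomial of the face numbers of the Hanner polytope. -/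
noncomputable def hannerPoly (a : ℝ) (n : ℕ) : ℕ[X] := facePoly (hannerPolytope a n)

lemma dual_apply_eq_mul (l : StrongDual ℝ (Fin (2 ^ 0) → ℝ)) (x : Fin (2 ^ 0) → ℝ) :
    l x = x 0 * l 1 := by
  have : x = x 0 • (1 : Fin (2 ^ 0) → ℝ) := by
    ext i
    have : i = 0 := Fin.ext (by simp)
    simp [this]
  conv_lhs => rw [this]
  simp

lemma mem_hannerPolytope_zero {a : ℝ} {x : Fin (2 ^ 0) → ℝ} :
    x ∈ hannerPolytope a 0 ↔ -1 ≤ x 0 ∧ x 0 ≤ 1 := by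
  constructor
  · exact fun h => h 0
  · intro h i
    have : i = 0 := Fin.ext (by simp)
    rw [this]; exact h

lemma surroundsZero_hannerPolytope (a : ℝ) (n : ℕ) : SurroundsZero (hannerPolytope a n) := by
  induction n with
  | zero =>
    refine ⟨mem_hannerPolytope_zero.2 (by simp), fun l hl => ?_⟩
    have hl1 : l 1 ≠ 0 := by
      intro h
      apply hl
      ext1 x
      rw [dual_apply_eq_mul, h]; simp
    rcases hl1.lt_or_gt with h | h
    · exact ⟨-1, mem_hannerPolytope_zero.2 (by simp), by simpa using h⟩
    · exact ⟨1, mem_hannerPolytope_zero.2 (by simp), h⟩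
  | succ n ih =>
    rw [hannerPolytope]
    split_ifs
    · rw [polyProd_eq_preimage]; exact (ih.prod ih).preimage _
    · rw [polySum_eq_preimage]; exact (ih.freeSum ih).preimage _

/-- The polar faces of the segment `[-1, 1]` are the empty face and the two end points. -/
lemma polarFaces_hannerPolytope_zero (a : ℝ) :
    polarFaces (hannerPolytope a 0) = {∅, {1}, {-1}} := by
  have hext : ∀ x y : Fin (2 ^ 0) → ℝ, x 0 = y 0 → x = y := fun x y h => by
    ext i
    have : i = 0 := Fin.ext (by simp)
    rw [this, h]
  have h1 : ∀ l : StrongDual ℝ (Fin (2 ^ 0) → ℝ), l 1 = 1 →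
      {x ∈ hannerPolytope a 0 | l x = 1} = {1} := by
    intro l hl
    ext x
    simp only [Set.mem_ofPred_eq, Set.mem_singleton_iff]
    rw [dual_apply_eq_mul, hl, mem_hannerPolytope_zero, mul_one]
    exact ⟨fun h => hext _ _ (by simpa using h.2), fun h => by simp [h]⟩
  have h2 : ∀ l : StrongDual ℝ (Fin (2 ^ 0) → ℝ), l 1 = -1 →
      {x ∈ hannerPolytope a 0 | l x = 1} = {-1} := by
    intro l hl
    ext x
    simp only [Set.mem_ofPred_eq, Set.mem_singleton_iff]
    rw [dual_apply_eq_mul, hl, mem_hannerPolytope_zero]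
    exact ⟨fun h => hext _ _ (by simp; linarith [h.2]), fun h => by simp [h]⟩
  have hbound : ∀ (l : StrongDual ℝ (Fin (2 ^ 0) → ℝ)) (x), x ∈ hannerPolytope a 0 →
      |l 1| ≤ 1 → l x ≤ 1 := by
    intro l x hx hl
    rw [dual_apply_eq_mul]
    have := abs_le.2 (mem_hannerPolytope_zero.1 hx)
    calc x 0 * l 1 ≤ |x 0| * |l 1| := by rw [← abs_mul]; exact le_abs_self _
      _ ≤ 1 := mul_le_one₀ this (abs_nonneg _) hl
  ext F
  simp only [Set.mem_insert_iff, Set.mem_singleton_iff]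
  constructor
  · rintro ⟨l, hl, rfl⟩
    have hp := hl 1 (mem_hannerPolytope_zero.2 (by simp))
    have hm := hl (-1) (mem_hannerPolytope_zero.2 (by simp))
    rw [map_neg] at hm
    by_cases e1 : l 1 = 1
    · exact Or.inr (Or.inl (h1 l e1))
    by_cases e2 : l 1 = -1
    · exact Or.inr (Or.inr (h2 l e2))
    left
    have : |l 1| < 1 := abs_lt.2 ⟨lt_of_le_of_ne (by linarith) (Ne.symm e2), lt_of_le_of_ne hp e1⟩
    rw [Set.eq_empty_iff_forall_notMem]
    rintro x ⟨hx, hlx⟩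
    rw [dual_apply_eq_mul] at hlx
    have hx' := abs_le.2 (mem_hannerPolytope_zero.1 hx)
    have habs : |x 0| * |l 1| = 1 := by rw [← abs_mul, hlx, abs_one]
    nlinarith [abs_nonneg (l 1)]
  · rintro (rfl | rfl | rfl)
    · exact empty_mem_polarFaces _
    · exact ⟨ContinuousLinearMap.proj 0, fun x hx => hbound _ x hx (by simp), (h1 _ (by simp)).symm⟩
    · exact ⟨-ContinuousLinearMap.proj 0, fun x hx => hbound _ x hx (by simp),
        (h2 _ (by simp)).symm⟩

lemma finite_exposedFaces_hannerPolytope (a : ℝ) (n : ℕ) :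
    (exposedFaces (hannerPolytope a n)).Finite := by
  induction n with
  | zero =>
    rw [(surroundsZero_hannerPolytope a 0).finite_exposedFaces_iff, polarFaces_hannerPolytope_zero]
    exact Set.toFinite _
  | succ n ih =>
    have hs := surroundsZero_hannerPolytope a n
    rw [hannerPolytope]
    split_ifs
    · rw [polyProd_eq_preimage]
      exact finite_exposedFaces_preimage _ (finite_exposedFaces_prod ih ih)
    · rw [polySum_eq_preimage]
      exact finite_exposedFaces_preimage _ (finite_exposedFaces_freeSum hs hs ih ih)

lemma faceNumber_hannerPolytope (a : ℝ) (n k : ℕ) :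
    faceNumber k (hannerPolytope a n) = (hannerPoly a n).coeff k := by
  rw [hannerPoly, facePoly, coeff_gradedPoly (finite_exposedFaces_hannerPolytope a n), faceNumber]
  congr 1
  ext F
  exact and_assoc.symm

lemma hannerPoly_succ_of_mem {a : ℝ} {n : ℕ} (h : n + 1 ∈ productSteps a) :
    hannerPoly a (n + 1) = hannerPoly a n * hannerPoly a n := by
  have hfin := finite_exposedFaces_hannerPolytope a n
  rw [hannerPoly, hannerPolytope, if_pos h, polyProd_eq_preimage, facePoly_preimage,
    facePoly_prod hfin hfin, hannerPoly]

lemma X_mul_hannerPoly_add_one (a : ℝ) (n : ℕ) :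
    X * hannerPoly a n + 1 = polarPoly (hannerPolytope a n) + X ^ (2 ^ n + 1) := by
  have := (surroundsZero_hannerPolytope a n).X_mul_facePoly_add_one
    (finite_exposedFaces_hannerPolytope a n)
  rwa [Module.finrank_fin_fun] at this

lemma X_mul_hannerPoly_succ_of_notMem {a : ℝ} {n : ℕ} (h : n + 1 ∉ productSteps a) :
    X * hannerPoly a (n + 1) + 1
      = polarPoly (hannerPolytope a n) * polarPoly (hannerPolytope a n)
        + X ^ (2 ^ (n + 1) + 1) := by
  have hs := surroundsZero_hannerPolytope a n
  have hfin := finite_exposedFaces_hannerPolytope a n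
  have hpol := hs.finite_exposedFaces_iff.1 hfin
  have := (hs.freeSum hs).X_mul_facePoly_add_one (finite_exposedFaces_freeSum hs hs hfin hfin)
  rw [polarPoly_freeSum hpol hpol, Module.finrank_prod, Module.finrank_fin_fun] at this
  rw [hannerPoly, hannerPolytope, if_neg h, polySum_eq_preimage, facePoly_preimage, this,
    pow_succ 2, mul_two]

lemma one_le_coeff_hannerPoly_top (a : ℝ) (n : ℕ) : 1 ≤ (hannerPoly a n).coeff (2 ^ n) := by
  have := congrArg (fun p : ℕ[X] => p.coeff (2 ^ n + 1)) (X_mul_hannerPoly_add_one a n)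
  simp [coeff_X_mul, coeff_one] at this
  omega

lemma coeff_polarPoly_zero (a : ℝ) (n : ℕ) : (polarPoly (hannerPolytope a n)).coeff 0 = 1 := by
  have := congrArg (fun p : ℕ[X] => p.coeff 0) (X_mul_hannerPoly_add_one a n)
  simp [coeff_X_pow] at this
  omega

lemma coeff_polarPoly_succ (a : ℝ) {n k : ℕ} (hk : k < 2 ^ n) :
    (polarPoly (hannerPolytope a n)).coeff (k + 1) = (hannerPoly a n).coeff k := by
  have := congrArg (fun p : ℕ[X] => p.coeff (k + 1)) (X_mul_hannerPoly_add_one a n)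
  simp [coeff_X_mul, coeff_one, coeff_X_pow, hk.ne] at this
  omega

lemma coeff_mul_coeff_le_coeff_mul (p q : ℕ[X]) (i j : ℕ) :
    p.coeff i * q.coeff j ≤ (p * q).coeff (i + j) := by
  rw [coeff_mul]
  exact Finset.single_le_sum (f := fun x : ℕ × ℕ => p.coeff x.1 * q.coeff x.2)
    (fun _ _ => Nat.zero_le _)
    (Finset.HasAntidiagonal.mem_antidiagonal.2 (rfl : (i, j).1 + (i, j).2 = i + j))

lemma coeff_mul_coeff_le_of_mem {a : ℝ} {n : ℕ} (h : n + 1 ∈ productSteps a) (i j : ℕ) :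
    (hannerPoly a n).coeff i * (hannerPoly a n).coeff j
      ≤ (hannerPoly a (n + 1)).coeff (i + j) := by
  rw [hannerPoly_succ_of_mem h]
  exact coeff_mul_coeff_le_coeff_mul _ _ _ _

lemma coeff_polarPoly_mul_le {a : ℝ} {n : ℕ} (h : n + 1 ∉ productSteps a) {i j k : ℕ}
    (hk : i + j = k + 1) :
    (polarPoly (hannerPolytope a n)).coeff i * (polarPoly (hannerPolytope a n)).coeff j
      ≤ (hannerPoly a (n + 1)).coeff k := by
  have := congrArg (fun p : ℕ[X] => p.coeff (k + 1)) (X_mul_hannerPoly_succ_of_notMem h)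
  simp only [coeff_add, coeff_X_mul, coeff_one, Nat.succ_ne_zero, if_false, add_zero] at this
  rw [this, ← hk]
  exact (coeff_mul_coeff_le_coeff_mul _ _ _ _).trans (Nat.le_add_right _ _)

/-- Joins of proper faces of the summands are faces of the free sum. -/
lemma coeff_mul_coeff_le_of_notMem {a : ℝ} {n : ℕ} (h : n + 1 ∉ productSteps a) {i j : ℕ}
    (hi : i < 2 ^ n) (hj : j < 2 ^ n) :
    (hannerPoly a n).coeff i * (hannerPoly a n).coeff j
      ≤ (hannerPoly a (n + 1)).coeff (i + j + 1) := by
  have := coeff_polarPoly_mul_le h (i := i + 1) (j := j + 1) (k := i + j + 1) (by ring)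
  rwa [coeff_polarPoly_succ a hi, coeff_polarPoly_succ a hj] at this

/-- Proper faces of a summand are faces of the free sum. -/
lemma coeff_le_of_notMem {a : ℝ} {n : ℕ} (h : n + 1 ∉ productSteps a) {k : ℕ} (hk : k < 2 ^ n) :
    (hannerPoly a n).coeff k ≤ (hannerPoly a (n + 1)).coeff k := by
  have := coeff_polarPoly_mul_le h (i := 0) (j := k + 1) (k := k) (by ring)
  rwa [coeff_polarPoly_zero, one_mul, coeff_polarPoly_succ a hk] at this

lemma two_le_coeff_hannerPoly_zero (a : ℝ) : 2 ≤ (hannerPoly a 0).coeff 0 := by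
  rw [← coeff_polarPoly_succ a (n := 0) (k := 0) (by norm_num), polarPoly, coeff_gradedPoly
    ((surroundsZero_hannerPolytope a 0).finite_exposedFaces_iff.1
      (finite_exposedFaces_hannerPolytope a 0))]
  have hne : ({1} : Set (Fin (2 ^ 0) → ℝ)) ≠ {-1} := by
    intro h
    have := congrFun (Set.singleton_injective h) 0
    norm_num at this
  refine (Set.ncard_pair hne).symm.le.trans (Set.ncard_le_ncard ?_ ?_)
  · rw [polarFaces_hannerPolytope_zero]
    have : ∀ x : Fin (2 ^ 0) → ℝ, x ≠ 0 → linDim {x} = 0 + 1 := fun x hx =>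
      finrank_span_singleton hx
    rintro F (rfl | rfl)
    · exact ⟨by simp, this _ one_ne_zero⟩
    · exact ⟨by simp, this _ (neg_ne_zero.2 one_ne_zero)⟩
  · refine Set.Finite.subset ?_ (fun F hF => hF.1)
    rw [polarFaces_hannerPolytope_zero]
    exact Set.toFinite _

lemma two_le_coeff_hannerPoly (a : ℝ) {n k : ℕ} (hk : k < 2 ^ n) :
    2 ≤ (hannerPoly a n).coeff k := by
  induction n generalizing k with
  | zero =>
    obtain rfl : k = 0 := by simpa using hk
    exact two_le_coeff_hannerPoly_zero a
  | succ n ih =>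
    have hpow : 2 ^ (n + 1) = 2 ^ n + 2 ^ n := by ring
    have hpos : 0 < 2 ^ n := by positivity
    by_cases h : n + 1 ∈ productSteps a
    · rcases lt_or_ge k (2 ^ n) with hlt | hge
      · have := coeff_mul_coeff_le_of_mem h k 0
        have h1 := ih hlt
        have h2 := ih hpos
        rw [add_zero] at this
        nlinarith
      · have := coeff_mul_coeff_le_of_mem h (2 ^ n) (k - 2 ^ n)
        have h1 := one_le_coeff_hannerPoly_top a n
        have h2 := ih (k := k - 2 ^ n) (by omega)
        rw [Nat.add_sub_cancel' hge] at this
        nlinarith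
    · rcases lt_or_ge k (2 ^ n) with hlt | hge
      · exact (ih hlt).trans (coeff_le_of_notMem h hlt)
      · have := coeff_mul_coeff_le_of_notMem h (i := 2 ^ n - 1) (j := k - 2 ^ n) (by omega)
          (by omega)
        have h1 := ih (k := 2 ^ n - 1) (by omega)
        have h2 := ih (k := k - 2 ^ n) (by omega)
        rw [show 2 ^ n - 1 + (k - 2 ^ n) + 1 = k by omega] at this
        nlinarith

lemma coeff_mul_pow_le_aeval (p : ℕ[X]) {x : ℝ} (hx : 0 ≤ x) (k : ℕ) :
    p.coeff k * x ^ k ≤ aeval x p := by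
  rw [aeval_eq_sum_range]
  simp only [nsmul_eq_mul]
  by_cases hk : k ≤ p.natDegree
  · exact Finset.single_le_sum (f := fun i => (p.coeff i : ℝ) * x ^ i)
      (fun i _ => by positivity) (Finset.mem_range_succ_iff.2 hk)
  · rw [coeff_eq_zero_of_natDegree_lt (not_le.1 hk), Nat.cast_zero, zero_mul]
    exact Finset.sum_nonneg fun i _ => by positivity

lemma two_le_aeval_hannerPoly (a : ℝ) (n : ℕ) {x : ℝ} (hx : 0 ≤ x) :
    2 ≤ aeval x (hannerPoly a n) := by
  have h1 := coeff_mul_pow_le_aeval (hannerPoly a n) hx 0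
  have h2 : (2 : ℝ) ≤ (hannerPoly a n).coeff 0 := by
    exact_mod_cast two_le_coeff_hannerPoly a (n := n) (k := 0) (by positivity)
  rw [pow_zero, mul_one] at h1
  exact h2.trans h1

lemma aeval_hannerPoly_succ_of_mem {a : ℝ} {n : ℕ} (h : n + 1 ∈ productSteps a) (x : ℝ) :
    aeval x (hannerPoly a (n + 1)) = aeval x (hannerPoly a n) ^ 2 := by
  rw [hannerPoly_succ_of_mem h, map_mul, sq]

/-- The two terms count the faces of a single summand and the joins of two faces. As long as
`x * F_n(x) ≤ 1`, the right-hand side is at most `3 * F_n(x)`. -/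
lemma aeval_hannerPoly_succ_le_of_notMem {a : ℝ} {n : ℕ} (h : n + 1 ∉ productSteps a) {x : ℝ}
    (hx0 : 0 < x) (hx1 : x ≤ 1) :
    aeval x (hannerPoly a (n + 1))
      ≤ 2 * aeval x (hannerPoly a n) + x * aeval x (hannerPoly a n) ^ 2 := by
  have h1 := congrArg (aeval x) (X_mul_hannerPoly_add_one a n)
  have h2 := congrArg (aeval x) (X_mul_hannerPoly_succ_of_notMem h)
  have h3 : (1 : ℝ) ≤ aeval x (polarPoly (hannerPolytope a n)) := by
    simpa [coeff_polarPoly_zero] using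
      coeff_mul_pow_le_aeval (polarPoly (hannerPolytope a n)) hx0.le 0
  simp only [map_add, map_mul, aeval_X, map_one, map_pow] at h1 h2
  set F := aeval x (hannerPoly a n)
  set F' := aeval x (hannerPoly a (n + 1))
  set G := aeval x (polarPoly (hannerPolytope a n))
  set y := x ^ 2 ^ n with hy
  have hy0 : 0 < y := by positivity
  have hy1 : y ≤ 1 := pow_le_one₀ hx0.le hx1
  have e1 : x ^ (2 ^ n + 1) = x * y := by rw [hy, pow_succ']
  have e2 : x ^ (2 ^ (n + 1) + 1) = x * y ^ 2 := by rw [hy, ← pow_mul, ← pow_succ, pow_succ']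
  rw [e1] at h1
  rw [e2] at h2
  have hG : G = 1 + x * (F - y) := by linarith
  have hFy : 0 ≤ F - y := by
    have : 0 ≤ x * (F - y) := by linarith
    exact nonneg_of_mul_nonneg_right this hx0
  have hF' : F' = 2 * (F - y) + x * (F - y) ^ 2 + y ^ 2 := by
    have : x * F' = x * (2 * (F - y) + x * (F - y) ^ 2 + y ^ 2) := by
      rw [hG] at h2; linear_combination h2
    exact mul_left_cancel₀ hx0.ne' this
  have hsq : x * (F - y) ^ 2 ≤ x * F ^ 2 := by
    apply mul_le_mul_of_nonneg_left _ hx0.le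
    exact pow_le_pow_left₀ hFy (by linarith) 2
  nlinarith

/-! ### Counting product steps -/

/-- `⌈a (n + 1)⌉`. For `a ∈ (0, 1)` it exceeds the number of product steps among `1, …, n` by
exactly one. -/
noncomputable def stepCount (a : ℝ) (n : ℕ) : ℕ := ⌈a * (n + 1)⌉₊

lemma mem_productSteps_iff {a : ℝ} (ha0 : 0 < a) (n : ℕ) :
    n ∈ productSteps a ↔ (⌈a * n⌉₊ : ℝ) < a * (n + 1) := by
  have hfloor : ∀ m : ℕ, n = ⌊(m : ℝ) / a⌋₊ ↔ a * n ≤ m ∧ (m : ℝ) < a * (n + 1) := by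
    intro m
    rw [eq_comm, Nat.floor_eq_iff (by positivity), le_div_iff₀ ha0, div_lt_iff₀ ha0, mul_comm,
      mul_comm a (n + 1 : ℝ)]
  constructor
  · rintro ⟨m, hm⟩
    obtain ⟨h1, h2⟩ := (hfloor m).1 hm
    exact lt_of_le_of_lt (by exact_mod_cast Nat.ceil_le.2 h1) h2
  · exact fun h => ⟨_, (hfloor _).2 ⟨Nat.le_ceil _, h⟩⟩

lemma stepCount_succ_of_mem {a : ℝ} (ha0 : 0 < a) (ha1 : a < 1) {n : ℕ}
    (h : n + 1 ∈ productSteps a) : stepCount a (n + 1) = stepCount a n + 1 := by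
  rw [mem_productSteps_iff ha0] at h
  push_cast at h
  rw [stepCount, stepCount]
  push_cast
  have h1 := Nat.ceil_lt_add_one (a := a * (n + 1 : ℝ)) (by positivity)
  have h2 := Nat.le_ceil (a * (n + 1 : ℝ))
  rw [Nat.ceil_eq_iff (by omega)]
  push_cast
  exact ⟨h, by linarith⟩

lemma stepCount_succ_of_notMem {a : ℝ} (ha0 : 0 < a) {n : ℕ}
    (h : n + 1 ∉ productSteps a) : stepCount a (n + 1) = stepCount a n := by
  rw [mem_productSteps_iff ha0] at h
  push_cast at h
  rw [stepCount, stepCount]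
  push_cast
  apply le_antisymm
  · exact Nat.ceil_le.2 (not_lt.1 h)
  · exact Nat.ceil_mono (by nlinarith)

lemma stepCount_mono {a : ℝ} (ha0 : 0 < a) : Monotone (stepCount a) := fun m n h =>
  Nat.ceil_mono (by gcongr)

lemma le_stepCount (a : ℝ) (n : ℕ) : a * (n + 1) ≤ stepCount a n := Nat.le_ceil _

lemma stepCount_lt {a : ℝ} (ha0 : 0 < a) (n : ℕ) : (stepCount a n : ℝ) < a * (n + 1) + 1 :=
  Nat.ceil_lt_add_one (by positivity)

/-! ### Lower bound -/

/-- The products of a given face with all vertices show that the least of `f_0, f_1, f_2` is at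
least squared at each product step. -/
lemma two_pow_two_pow_le_coeff {a : ℝ} (ha0 : 0 < a) (ha1 : a < 1) {m : ℕ} (hm : 2 ≤ m) :
    ∀ i ≤ 2, 2 ^ 2 ^ (stepCount a m - 3) ≤ (hannerPoly a m).coeff i := by
  induction m, hm using Nat.le_induction with
  | base =>
    have : stepCount a 2 ≤ 3 := Nat.ceil_le.2 (by push_cast; linarith)
    rw [Nat.sub_eq_zero_of_le this]
    exact fun i hi => two_le_coeff_hannerPoly a (by omega)
  | succ m hm ih =>
    intro i hi
    by_cases h : m + 1 ∈ productSteps a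
    · rw [stepCount_succ_of_mem ha0 ha1 h]
      calc 2 ^ 2 ^ (stepCount a m + 1 - 3) ≤ 2 ^ 2 ^ (stepCount a m - 3 + 1) :=
            Nat.pow_le_pow_right two_pos (Nat.pow_le_pow_right two_pos (by omega))
        _ = 2 ^ 2 ^ (stepCount a m - 3) * 2 ^ 2 ^ (stepCount a m - 3) := by
            rw [← pow_add, pow_succ 2 (stepCount a m - 3), mul_two]
        _ ≤ (hannerPoly a m).coeff i * (hannerPoly a m).coeff 0 :=
            Nat.mul_le_mul (ih i hi) (ih 0 (by omega))
        _ ≤ _ := coeff_mul_coeff_le_of_mem h i 0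
    · rw [stepCount_succ_of_notMem ha0 h]
      have : 2 ^ 2 ≤ 2 ^ m := Nat.pow_le_pow_right two_pos hm
      exact (ih i hi).trans (coeff_le_of_notMem h (by omega))

/-- A dimension `k ≈ 2 ^ j` can be split evenly among the `2 ^ j` copies of the polytope of level
`m` that make up the one of level `m + j`, so that each copy carries a face of dimension at
most two. -/
lemma pow_two_pow_le_coeff {a : ℝ} {m : ℕ} (hm : 2 ≤ m) {B : ℕ}
    (hB : ∀ i ≤ 2, B ≤ (hannerPoly a m).coeff i) (j : ℕ) :
    ∀ k, 2 ^ j ≤ k + 1 → k ≤ 2 ^ (j + 1) → B ^ 2 ^ j ≤ (hannerPoly a (m + j)).coeff k := by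
  induction j with
  | zero =>
    intro k _ hk
    simpa using hB k (by simpa using hk)
  | succ j ih =>
    intro k hk1 hk2
    rw [pow_succ 2 j] at hk1
    rw [pow_succ 2 (j + 1)] at hk2
    have hpos : 0 < 2 ^ j := by positivity
    have hsq : B ^ 2 ^ (j + 1) = B ^ 2 ^ j * B ^ 2 ^ j := by rw [← pow_add, pow_succ, mul_two]
    rw [hsq, ← add_assoc]
    by_cases h : m + j + 1 ∈ productSteps a
    · have := coeff_mul_coeff_le_of_mem h (k / 2) (k - k / 2)
      rw [show k / 2 + (k - k / 2) = k by omega] at this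
      exact (Nat.mul_le_mul (ih _ (by omega) (by omega)) (ih _ (by omega) (by omega))).trans this
    · have hlt : 2 ^ (j + 1) < 2 ^ (m + j) := Nat.pow_lt_pow_right one_lt_two (by omega)
      have := coeff_mul_coeff_le_of_notMem h (i := (k - 1) / 2) (j := k - 1 - (k - 1) / 2)
        (by omega) (by omega)
      rw [show (k - 1) / 2 + (k - 1 - (k - 1) / 2) + 1 = k by omega] at this
      exact (Nat.mul_le_mul (ih _ (by omega) (by omega)) (ih _ (by omega) (by omega))).trans this

lemma log_coeff_lower_bound {a : ℝ} (ha0 : 0 < a) (ha1 : a < 1) {m : ℕ} (hm : 2 ≤ m) (j : ℕ)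
    {k : ℕ} (hk1 : 2 ^ j ≤ k) (hk2 : k < 2 ^ (j + 1)) :
    Real.log 2 / 8 * (2 ^ j * 2 ^ stepCount a m)
      ≤ Real.log ((hannerPoly a (m + j)).coeff k) := by
  have h := pow_two_pow_le_coeff hm (two_pow_two_pow_le_coeff ha0 ha1 hm) j k (by omega) hk2.le
  rw [← pow_mul] at h
  have h' : (2 : ℝ) ^ (2 ^ (stepCount a m - 3) * 2 ^ j) ≤ (hannerPoly a (m + j)).coeff k := by
    exact_mod_cast h
  have hlog := Real.log_le_log (by positivity) h'
  rw [Real.log_pow] at hlog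
  push_cast at hlog
  refine le_trans ?_ hlog
  have hsub : (2 : ℝ) ^ stepCount a m ≤ 2 ^ (stepCount a m - 3) * 8 := by
    rw [show (8 : ℝ) = 2 ^ 3 by norm_num, ← pow_add]
    exact pow_le_pow_right₀ one_le_two (by omega)
  have hl : 0 < Real.log 2 := Real.log_pos one_lt_two
  calc Real.log 2 / 8 * (2 ^ j * 2 ^ stepCount a m)
      ≤ Real.log 2 / 8 * (2 ^ j * (2 ^ (stepCount a m - 3) * 8)) := by gcongr
    _ = 2 ^ (stepCount a m - 3) * 2 ^ j * Real.log 2 := by ring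

/-! ### Upper bound -/

/-- At this `x` the products `x * F_i(x)` stay below `1` up to the level `m`, so that `log F_i(x)`
doubles at product steps and grows by at most `log 3` at the other steps. The subtracted multiple of
`2 ^ (-a i)` makes room for these additive constants in the induction. -/
lemma log_aeval_le {a : ℝ} (ha0 : 0 < a) (ha1 : a < 1) {B : ℝ} {m : ℕ} {x : ℝ}
    (hB : Real.log 3 / (1 - 2 ^ (-a)) + Real.log (aeval (1 : ℝ) (hannerPoly a 0)) ≤ B)
    (hx : x = Real.exp (-(B * 2 ^ stepCount a m))) (i : ℕ) (hi : i ≤ m) :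
    Real.log (aeval x (hannerPoly a i))
      ≤ 2 ^ stepCount a i * (B - Real.log 3 / (1 - 2 ^ (-a)) * ((2 : ℝ) ^ (-a)) ^ i) := by
  set r : ℝ := 2 ^ (-a) with hr
  set B' : ℝ := Real.log 3 / (1 - r) with hB'
  have hr0 : 0 < r := by positivity
  have hr1 : r < 1 := Real.rpow_lt_one_of_one_lt_of_neg one_lt_two (by linarith)
  have hB'0 : 0 < B' := div_pos (Real.log_pos (by norm_num)) (by linarith)
  have hF1 : 0 ≤ Real.log (aeval (1 : ℝ) (hannerPoly a 0)) :=
    Real.log_nonneg (by linarith [two_le_aeval_hannerPoly a 0 zero_le_one])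
  have hB0 : 0 < B := by linarith
  have hx0 : 0 < x := hx ▸ Real.exp_pos _
  have hx1 : x ≤ 1 := by
    rw [hx, Real.exp_le_one_iff]
    have : 0 < B * 2 ^ stepCount a m := by positivity
    linarith
  have hpos : ∀ i, 0 < aeval x (hannerPoly a i) := fun i => by
    linarith [two_le_aeval_hannerPoly a i hx0.le]
  induction i with
  | zero =>
    have hmono : aeval x (hannerPoly a 0) ≤ aeval (1 : ℝ) (hannerPoly a 0) := by
      rw [aeval_eq_sum_range, aeval_eq_sum_range]
      refine Finset.sum_le_sum fun i _ => ?_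
      simp only [nsmul_eq_mul]
      gcongr
    have h1 := Real.log_le_log (hpos 0) hmono
    have h2 : (1 : ℝ) ≤ 2 ^ stepCount a 0 := one_le_pow₀ one_le_two
    rw [pow_zero, mul_one]
    nlinarith
  | succ i ih =>
    have ih := ih (by omega)
    have hri : r ^ (i + 1) ≤ r ^ i := pow_le_pow_of_le_one hr0.le hr1.le (by omega)
    by_cases h : i + 1 ∈ productSteps a
    · rw [aeval_hannerPoly_succ_of_mem h, Real.log_pow, stepCount_succ_of_mem ha0 ha1 h, pow_succ 2]
      push_cast
      have : 2 ^ stepCount a i * (B - B' * r ^ i) ≤ 2 ^ stepCount a i * (B - B' * r ^ (i + 1)) := by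
        gcongr
      linarith
    · rw [stepCount_succ_of_notMem ha0 h]
      have hle : Real.log (aeval x (hannerPoly a i)) ≤ B * 2 ^ stepCount a m := by
        have h1 : (2 : ℝ) ^ stepCount a i ≤ 2 ^ stepCount a m :=
          pow_le_pow_right₀ one_le_two (stepCount_mono ha0 (by omega))
        have h2 : 0 ≤ B' * r ^ i := by positivity
        calc _ ≤ 2 ^ stepCount a i * (B - B' * r ^ i) := ih
          _ ≤ 2 ^ stepCount a i * B := by gcongr; linarith
          _ ≤ 2 ^ stepCount a m * B := by gcongr
          _ = _ := mul_comm _ _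
      have hxF : x * aeval x (hannerPoly a i) ≤ 1 := by
        have := (Real.log_le_iff_le_exp (hpos i)).1 hle
        calc x * aeval x (hannerPoly a i) ≤ x * Real.exp (B * 2 ^ stepCount a m) := by gcongr
          _ = 1 := by rw [hx, ← Real.exp_add, neg_add_cancel, Real.exp_zero]
      have hstep : aeval x (hannerPoly a (i + 1)) ≤ 3 * aeval x (hannerPoly a i) := by
        have := aeval_hannerPoly_succ_le_of_notMem h hx0 hx1
        nlinarith [hpos i]
      have hlog := Real.log_le_log (hpos _) hstep
      rw [Real.log_mul (by norm_num) (hpos i).ne'] at hlog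
      -- The discrepancy bound `a * i ≤ stepCount a i` in exponential form.
      have hone : 1 ≤ 2 ^ stepCount a i * r ^ i := by
        have h1 := le_stepCount a i
        rw [hr, ← Real.rpow_natCast, ← Real.rpow_natCast, ← Real.rpow_mul two_pos.le,
          ← Real.rpow_add two_pos]
        exact Real.one_le_rpow one_le_two (by nlinarith)
      have hconst : Real.log 3 ≤ 2 ^ stepCount a i * r ^ i * Real.log 3 :=
        le_mul_of_one_le_left (Real.log_nonneg (by norm_num)) hone
      have hl3 : Real.log 3 = B' * (1 - r) := by rw [hB', div_mul_cancel₀]; linarith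
      calc Real.log (aeval x (hannerPoly a (i + 1)))
          ≤ Real.log 3 + Real.log (aeval x (hannerPoly a i)) := hlog
        _ ≤ 2 ^ stepCount a i * r ^ i * (B' * (1 - r))
            + 2 ^ stepCount a i * (B - B' * r ^ i) := by rw [← hl3]; linarith
        _ = 2 ^ stepCount a i * (B - B' * r ^ (i + 1)) := by ring

/-- Beyond the level `m` the crude estimate `F_{i+1} ≤ 3 F_i ^ 2` is good enough. -/
lemma log_aeval_add_le {a : ℝ} {m : ℕ} {x T : ℝ} (hx0 : 0 < x) (hx1 : x ≤ 1)
    (hT : Real.log (aeval x (hannerPoly a m)) ≤ T) (j : ℕ) :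
    Real.log (aeval x (hannerPoly a (m + j))) ≤ 2 ^ j * (T + Real.log 3) - Real.log 3 := by
  have htwo : ∀ i, 2 ≤ aeval x (hannerPoly a i) := fun i => two_le_aeval_hannerPoly a i hx0.le
  induction j with
  | zero => simpa using hT
  | succ j ih =>
    have hstep : aeval x (hannerPoly a (m + j + 1)) ≤ 3 * aeval x (hannerPoly a (m + j)) ^ 2 := by
      by_cases h : m + j + 1 ∈ productSteps a
      · rw [aeval_hannerPoly_succ_of_mem h]
        nlinarith [sq_nonneg (aeval x (hannerPoly a (m + j)))]
      · have := aeval_hannerPoly_succ_le_of_notMem h hx0 hx1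
        nlinarith [htwo (m + j)]
    have hlog := Real.log_le_log (by linarith [htwo (m + j + 1)]) hstep
    have hne : aeval x (hannerPoly a (m + j)) ≠ 0 := by linarith [htwo (m + j)]
    rw [Real.log_mul (by norm_num) (pow_ne_zero 2 hne), Real.log_pow] at hlog
    rw [← add_assoc, pow_succ]
    push_cast at hlog
    linarith

lemma exists_log_coeff_upper_bound {a : ℝ} (ha0 : 0 < a) (ha1 : a < 1) :
    ∃ C : ℝ, 0 < C ∧ ∀ m j k : ℕ, 0 < (hannerPoly a (m + j)).coeff k → k < 2 ^ (j + 1) →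
      Real.log ((hannerPoly a (m + j)).coeff k) ≤ C * (2 ^ j * 2 ^ stepCount a m) := by
  set B' := Real.log 3 / (1 - 2 ^ (-a)) with hB'
  have hl3 : 0 < Real.log 3 := Real.log_pos (by norm_num)
  have hr1 : (2 : ℝ) ^ (-a) < 1 := Real.rpow_lt_one_of_one_lt_of_neg one_lt_two (by linarith)
  have hB'0 : 0 < B' := div_pos hl3 (by linarith)
  have hF1 : 0 ≤ Real.log (aeval (1 : ℝ) (hannerPoly a 0)) :=
    Real.log_nonneg (by linarith [two_le_aeval_hannerPoly a 0 zero_le_one])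
  set B := B' + Real.log (aeval (1 : ℝ) (hannerPoly a 0)) with hB
  have hB0 : 0 < B := by linarith
  refine ⟨3 * B + Real.log 3, by positivity, fun m j k hpos hk => ?_⟩
  set T := B * 2 ^ stepCount a m with hT
  have hT0 : 0 < T := by positivity
  set x := Real.exp (-T) with hx
  have hx0 : 0 < x := Real.exp_pos _
  have hx1 : x ≤ 1 := Real.exp_le_one_iff.2 (by linarith)
  have h1 : Real.log (aeval x (hannerPoly a m)) ≤ T := by
    refine (log_aeval_le ha0 ha1 hB.ge hx m le_rfl).trans ?_
    have : 0 ≤ B' * ((2 : ℝ) ^ (-a)) ^ m := by positivity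
    rw [hT, mul_comm B]
    gcongr
    linarith
  have h2 := log_aeval_add_le hx0 hx1 h1 j
  have hposR : (0 : ℝ) < (hannerPoly a (m + j)).coeff k := by exact_mod_cast hpos
  have h3 := Real.log_le_log (by positivity)
    (coeff_mul_pow_le_aeval (hannerPoly a (m + j)) hx0.le k)
  rw [Real.log_mul hposR.ne' (by positivity), Real.log_pow, hx, Real.log_exp, ← hx] at h3
  have h4 : (k : ℝ) ≤ 2 ^ j * 2 := by rw [← pow_succ]; exact_mod_cast hk.le
  have h5 : (1 : ℝ) ≤ 2 ^ stepCount a m := one_le_pow₀ one_le_two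
  have h6 : k * T ≤ 2 ^ j * 2 * T := by gcongr
  calc Real.log ((hannerPoly a (m + j)).coeff k)
      ≤ 2 ^ j * (T + Real.log 3) + 2 ^ j * 2 * T := by linarith
    _ = 2 ^ j * (3 * T + Real.log 3 * 1) := by ring
    _ ≤ 2 ^ j * (3 * T + Real.log 3 * 2 ^ stepCount a m) := by gcongr
    _ = (3 * B + Real.log 3) * (2 ^ j * 2 ^ stepCount a m) := by rw [hT]; ring

/-! ### The asymptotics -/

/-- The two-sided bound holds for every `a ∈ (0, 1)`, rational or not, since the number of product
steps in any interval of length `L` is `a L` up to a bounded error. -/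
lemma exists_log_faceNumber_bounds {a δ : ℝ} (ha0 : 0 < a) (ha1 : a < 1) (hδ0 : 0 < δ)
    (hδ1 : δ < 1) :
    ∃ c C : ℝ, 0 < c ∧ 0 < C ∧ ∀ n : ℕ, 1 ≤ n → ∀ d : ℝ, d = (2 : ℝ) ^ n →
      c * d ^ (a + δ * (1 - a)) ≤ Real.log (faceNumber ⌊d ^ δ⌋₊ (hannerPolytope a n)) ∧
      Real.log (faceNumber ⌊d ^ δ⌋₊ (hannerPolytope a n)) ≤ C * d ^ (a + δ * (1 - a)) := by
  obtain ⟨C, hC0, hC⟩ := exists_log_coeff_upper_bound ha0 ha1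
  have hl : 0 < Real.log 2 := Real.log_pos one_lt_two
  refine ⟨min (Real.log 2 / 16) (Real.log 2 / 2 ^ (1 / (1 - δ))), C * 4,
    lt_min (by positivity) (by positivity), by positivity, ?_⟩
  rintro n hn d rfl
  have hdpow : ∀ s : ℝ, ((2 : ℝ) ^ n) ^ s = 2 ^ (n * s) := fun s => by
    rw [← Real.rpow_natCast, ← Real.rpow_mul two_pos.le]
  rw [faceNumber_hannerPolytope, hdpow, hdpow]
  set k := ⌊(2 : ℝ) ^ (n * δ)⌋₊ with hk
  have hk0 : k ≠ 0 := by
    have : 1 ≤ k := Nat.le_floor (by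
      push_cast; exact Real.one_le_rpow one_le_two (by positivity))
    omega
  set j := Nat.log 2 k with hj
  have hjk : 2 ^ j ≤ k := Nat.pow_log_le_self 2 hk0
  have hkj : k < 2 ^ (j + 1) := Nat.lt_pow_succ_log_self one_lt_two k
  have hjn : (j : ℝ) ≤ n * δ := by
    have h1 : (k : ℝ) ≤ 2 ^ (n * δ) := Nat.floor_le (by positivity)
    have h2 : (2 : ℝ) ^ j ≤ k := by exact_mod_cast hjk
    rw [← Real.rpow_le_rpow_left_iff one_lt_two, Real.rpow_natCast]
    exact h2.trans h1
  have hnj : n * δ ≤ j + 1 := by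
    have h1 : (2 : ℝ) ^ (n * δ) < k + 1 := Nat.lt_floor_add_one _
    have h2 : (k : ℝ) + 1 ≤ 2 ^ (j + 1) := by exact_mod_cast hkj
    rw [← Real.rpow_le_rpow_left_iff one_lt_two, ← Nat.cast_succ, Real.rpow_natCast]
    exact h1.le.trans h2
  have hn0 : (0 : ℝ) ≤ n := Nat.cast_nonneg n
  have hjn' : j ≤ n := by
    have : (j : ℝ) ≤ n := by nlinarith
    exact_mod_cast this
  have hn1 : (1 : ℝ) ≤ n := by exact_mod_cast hn
  have hklt : k < 2 ^ n := by
    rw [Nat.floor_lt (by positivity)]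
    push_cast
    rw [← Real.rpow_natCast, Real.rpow_lt_rpow_left_iff one_lt_two]
    nlinarith
  have hcoeff : 2 ≤ (hannerPoly a n).coeff k := two_le_coeff_hannerPoly a hklt
  obtain ⟨m, hmn⟩ : ∃ m, n = m + j := ⟨n - j, by omega⟩
  have hmnR : (n : ℝ) = m + j := by exact_mod_cast hmn
  have hprod : (2 : ℝ) ^ j * 2 ^ stepCount a m = 2 ^ ((j : ℝ) + stepCount a m) := by
    rw [Real.rpow_add two_pos, Real.rpow_natCast, Real.rpow_natCast]
  have hstep1 := le_stepCount a m
  have hstep2 := stepCount_lt ha0 m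
  constructor
  · rcases le_or_gt 2 m with hm | hm
    · have hlow := log_coeff_lower_bound ha0 ha1 hm j hjk hkj
      rw [← hmn] at hlow
      refine le_trans ?_ hlow
      have hexp : (2 : ℝ) ^ (n * (a + δ * (1 - a))) ≤ 2 * (2 ^ j * 2 ^ stepCount a m) := by
        rw [hprod, ← Real.rpow_one_add' two_pos.le (by positivity)]
        refine Real.rpow_le_rpow_of_exponent_le one_le_two ?_
        nlinarith
      calc min (Real.log 2 / 16) (Real.log 2 / 2 ^ (1 / (1 - δ))) * 2 ^ (n * (a + δ * (1 - a)))
          ≤ Real.log 2 / 16 * (2 * (2 ^ j * 2 ^ stepCount a m)) := by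
            gcongr
            exact min_le_left _ _
        _ = _ := by ring
    · -- Here `n (1 - δ) ≤ 1`, so that `d` is bounded.
      have hm1 : (m : ℝ) ≤ 1 := by exact_mod_cast Nat.le_of_lt_succ hm
      have hexp : (2 : ℝ) ^ (n * (a + δ * (1 - a))) ≤ 2 ^ (1 / (1 - δ)) := by
        refine Real.rpow_le_rpow_of_exponent_le one_le_two ?_
        rw [le_div_iff₀ (by linarith)]
        have h1 : (n : ℝ) * (1 - δ) ≤ 1 := by linarith
        have h2 : a + δ * (1 - a) ≤ 1 := by nlinarith
        have h3 : 0 ≤ (n : ℝ) * (1 - δ) := mul_nonneg hn0 (by linarith)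
        nlinarith
      calc min (Real.log 2 / 16) (Real.log 2 / 2 ^ (1 / (1 - δ))) * 2 ^ (n * (a + δ * (1 - a)))
          ≤ Real.log 2 / 2 ^ (1 / (1 - δ)) * 2 ^ (1 / (1 - δ)) := by
            gcongr
            exact min_le_right _ _
        _ = Real.log 2 := div_mul_cancel₀ _ (by positivity)
        _ ≤ _ := Real.log_le_log two_pos (by exact_mod_cast hcoeff)
  · have hup := hC m j k (by rw [← hmn]; omega) hkj
    rw [← hmn] at hup
    refine hup.trans ?_
    rw [mul_assoc]
    refine mul_le_mul_of_nonneg_left ?_ hC0.le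
    rw [hprod, show (4 : ℝ) = 2 ^ (2 : ℝ) by norm_num, ← Real.rpow_add two_pos]
    refine Real.rpow_le_rpow_of_exponent_le one_le_two ?_
    nlinarith

theorem mainTheorem1 (a δ : ℝ) (ha0 : 0 < a) (ha1 : a < 1) (hδ0 : 0 < δ) (hδ1 : δ < 1) :
    ((∃ q : ℚ, (q : ℝ) = a) →
      ∃ c C : ℝ, 0 < c ∧ 0 < C ∧ ∀ n : ℕ, 1 ≤ n → ∀ d : ℝ, d = (2 : ℝ) ^ n →
        c * d ^ (a + δ * (1 - a)) ≤ Real.log (faceNumber ⌊d ^ δ⌋₊ (hannerPolytope a n)) ∧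
        Real.log (faceNumber ⌊d ^ δ⌋₊ (hannerPolytope a n)) ≤ C * d ^ (a + δ * (1 - a))) ∧
    (Irrational a →
      ∃ C : ℝ, 0 < C ∧ ∀ n : ℕ, 1 ≤ n → ∀ d : ℝ, d = (2 : ℝ) ^ n →
        ∃ ε : ℝ, |ε| ≤ C / √(Real.log d) ∧
          Real.log (faceNumber ⌊d ^ δ⌋₊ (hannerPolytope a n)) =
            d ^ (a + δ * (1 - a) + ε)) := by
  obtain ⟨c, C, hc, hC, h⟩ := exists_log_faceNumber_bounds ha0 ha1 hδ0 hδ1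
  refine ⟨fun _ => ⟨c, C, hc, hC, h⟩, fun _ => ?_⟩
  have hl : 0 < Real.log 2 := Real.log_pos one_lt_two
  refine ⟨(|Real.log c| + |Real.log C| + 1) / √(Real.log 2), by positivity, fun n hn d hd => ?_⟩
  obtain ⟨h1, h2⟩ := h n hn d hd
  set L := Real.log (faceNumber ⌊d ^ δ⌋₊ (hannerPolytope a n))
  set s := a + δ * (1 - a)
  have hd2 : 2 ≤ d := by rw [hd]; exact le_self_pow₀ one_le_two (by omega)
  have hd0 : 0 < d := by linarith
  have hlogd : Real.log 2 ≤ Real.log d := Real.log_le_log two_pos hd2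
  have hlogd0 : 0 < Real.log d := hl.trans_le hlogd
  have hL : 0 < L := lt_of_lt_of_le (by positivity) h1
  have hlow := Real.log_le_log (by positivity) h1
  have hupp := Real.log_le_log hL h2
  rw [Real.log_mul (by positivity) (by positivity), Real.log_rpow hd0] at hlow hupp
  -- `d ^ ε` is the bounded quotient `L / d ^ s`, whence even `ε = O(1 / log d)`.
  refine ⟨(Real.log L - s * Real.log d) / Real.log d, ?_, ?_⟩
  · have habs : |Real.log L - s * Real.log d| ≤ |Real.log c| + |Real.log C| + 1 := by
      rw [abs_le]
      constructor
      · linarith [neg_abs_le (Real.log c), abs_nonneg (Real.log C)]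
      · linarith [le_abs_self (Real.log C), abs_nonneg (Real.log c)]
    have hsqrt : √(Real.log 2) * √(Real.log d) ≤ Real.log d := by
      calc √(Real.log 2) * √(Real.log d) ≤ √(Real.log d) * √(Real.log d) := by gcongr
        _ = Real.log d := Real.mul_self_sqrt hlogd0.le
    rw [abs_div, abs_of_pos hlogd0, div_div]
    gcongr
  · rw [Real.rpow_def_of_pos hd0]
    have : Real.log d * (s + (Real.log L - s * Real.log d) / Real.log d) = Real.log L := by
      field_simp
      ring
    rw [this, Real.exp_log hL]
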